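/- Let $(M,g)$ be a spacetime: a smooth, Hausdorff, connected, paracompact $n$-manifold with a smooth time-orientable Lorentz metric. Let $\phi:M\to\hat M$ be an envelopment, that is, a smooth open embedding into a smooth, Hausdorff, connected, paracompact manifold of the same dimension, and let $\partial_\phi M$ be the topological boundary of $\phi(M)$ in $\hat M$. Abstract boundary. A boundary set is a non-empty subset of $\partial_\psi M$ for some envelopment $\psi$ of $M$. A boundary set $B\subseteq\partial_\psi M$ covers $B'\subseteq\partial_{\psi'}M$ if for every open $U\supseteq B$ there is an open $U'\supseteq B'$ with $\psi\circ\psi'^{-1}(U'\cap\psi'(M))\subseteq U$; two boundary sets are equivalent if each covers the other. The abstract boundary $a$ of $M$ is the set of equivalence classes that contain a singleton $\{p\}$, and such a class is written $[p]$. The point $[p]$, $p\in\partial_\psi M$, is attached to an open set $O\subseteq M$ if every open neighbourhood of $p$ meets $\psi(O)$. The set $a$ carries the topology induced from the attached point topology on $M\sqcup a$, which has as a basis the sets $O\cup B_O\cup C$ with $O\subseteq M$ open, $B_O$ the set of all abstract boundary points attached to $O$, and $C\subseteq a$ arbitrary. Modified $g$ boundary. Let $G$ be the set of non-zero tangent vectors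 $(p,\xi)$ of $M$, and for $(p,\xi)\in G$ let $\gamma_p:[0,b)\to M$, $0<b\le\infty$, be the affinely parametrized geodesic with $\gamma_p(0)=p$, $\dot\gamma_p(0)=\xi$, extended as far as possible. For $O\subseteq M$ open let $S(O)$ be the set of those $(p,\xi)\in G$ for which $\gamma_p$ lies in $O$ and for which there is a boundary point $\hat p\in\partial_\phi M$ with $[\hat p]$ attached to $O$ such that for every open neighbourhood $N$ of $\hat p$ some subcurve of $\phi(\gamma_p)$ lies in $\phi(O)\cap N$. Give $G$ the topology generated by the sets $S(O)$. A geodesic $\gamma_p$ approaches $[\hat p]$, $\hat p\in\partial_\phi M$, if $\phi(\gamma_p(t))\to\hat p$ as $t\to b$. On the subspace $G_\phi\subseteq G$ of those $(p,\xi)$ whose geodesic approaches some $[\hat p]$ with $\hat p\in\partial_\phi M$, let $(p,\xi)\sim(q,\eta)$ if their geodesics approach the same abstract boundary point $[\hat p]$, $\hat p\in\partial_\phi M$. Let $\tilde g$ be the quotient $G_\phi/{\sim}$ with the quotient topology. The maps. Let $\phi(M)_{geo}$ be the set of curves $\phi(\gamma_p)$, $(p,\xi)\in G_\phi$, modulo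 the equivalence relation under which two curves are related if they belong to the same geodesic, followed in the same direction, or approach the same abstract boundary point $[\hat p]$, $\hat p\in\partial_\phi M$. Let $r:\tilde g\to\phi(M)_{geo}$ be induced by $(p,\xi)\mapsto[\phi(\gamma_p)]$, and let $L:\phi(M)_{geo}\to a$ send a class of curves to the abstract boundary point that they approach. Theorem. The composite $L\circ r:\tilde g\to a$ sends the class of $(p,\xi)$ to the abstract boundary point $[\hat p]$, where $\hat p\in\partial_\phi M$ is the point that $\phi(\gamma_p)$ approaches, and it is a homeomorphism from $\tilde g$ onto its image in $a$. -/

import Mathlib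

open Set Topology
open scoped Manifold ContDiff

universe u

noncomputable section

namespace SpacetimeBoundary

/-! ### Parametrized curves -/

/-- A parametrized curve `[a, b) → X` with `a < b ≤ ∞`.  Only the values on `[a, b)` matter. -/
structure Curve (X : Type u) where
  /-- the initial parameter `a` -/
  lo : ℝ
  /-- the final parameter `b`, possibly infinite -/
  hi : EReal
  lt : (lo : EReal) < hi
  /-- the curve itself (the values off `[a, b)` are irrelevant) -/
  toFun : ℝ → X

namespace Curve

variable {X Y : Type u}

/-- The parameter interval `[a, b)`. -/
def domain (γ : Curve X) : Set ℝ := {t | γ.lo ≤ t ∧ (t : EReal) < γ.hi}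

/-- The set of points through which the curve passes. -/
def trace (γ : Curve X) : Set X := γ.toFun '' γ.domain

/-- `γ'` is a subcurve of `γ`: `a ≤ a' < b' ≤ b` and `γ'` is the restriction of `γ` to
`[a', b')`. -/
def IsSubcurve (γ' γ : Curve X) : Prop :=
  γ.lo ≤ γ'.lo ∧ γ'.hi ≤ γ.hi ∧ ∀ t ∈ γ'.domain, γ'.toFun t = γ.toFun t

/-- The composition of a curve with a map. -/
def map (f : X → Y) (γ : Curve X) : Curve Y where
  lo := γ.lo
  hi := γ.hi
  lt := γ.lt
  toFun := f ∘ γ.toFun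

/-- The curve approaches the point `x`: `γ t → x` as `t → b` in `[a, b)`. -/
def Approaches [TopologicalSpace X] (γ : Curve X) (x : X) : Prop :=
  ∀ N ∈ 𝓝 x, ∃ t₀ ∈ γ.domain, ∀ t ∈ γ.domain, t₀ ≤ t → γ.toFun t ∈ N

/-- `c₂` runs along a final portion of `c₁`, up to an increasing affine change of parameter. -/
def IsTail (c₁ c₂ : Curve X) : Prop :=
  ∃ s k : ℝ, 0 < k ∧
    (∀ t, c₂.lo ≤ t → (t ∈ c₂.domain ↔ s + k * t ∈ c₁.domain)) ∧
    ∀ t ∈ c₂.domain, c₂.toFun t = c₁.toFun (s + k * t)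

/-- The two curves are portions of one geodesic, followed in the same direction to its end. -/
def SameGeodesic (c₁ c₂ : Curve X) : Prop := IsTail c₁ c₂ ∨ IsTail c₂ c₁

theorem Approaches.unique [TopologicalSpace X] [T2Space X] {γ : Curve X} {x y : X}
    (hx : γ.Approaches x) (hy : γ.Approaches y) : x = y := by
  by_contra hne
  obtain ⟨U, V, hU, hV, hxU, hyV, hd⟩ := t2_separation hne
  obtain ⟨t₁, ht₁, h₁⟩ := hx U (hU.mem_nhds hxU)
  obtain ⟨t₂, ht₂, h₂⟩ := hy V (hV.mem_nhds hyV)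
  rcases le_total t₁ t₂ with h | h
  · exact disjoint_left.1 hd (h₁ t₂ ht₂ h) (h₂ t₂ ht₂ le_rfl)
  · exact disjoint_left.1 hd (h₁ t₁ ht₁ le_rfl) (h₂ t₁ ht₁ h)

theorem IsTail.approaches [TopologicalSpace X] {c₁ c₂ : Curve X} {x : X}
    (h : IsTail c₁ c₂) (hx : c₁.Approaches x) : c₂.Approaches x := by
  obtain ⟨s, k, hk, hd, he⟩ := h
  intro N hN
  obtain ⟨t₀, ht₀, h₀⟩ := hx N hN
  have hkey : s + k * ((t₀ - s) / k) = t₀ := by field_simp; ring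
  have hs2 : c₂.lo ∈ c₂.domain := ⟨le_rfl, c₂.lt⟩
  refine ⟨max c₂.lo ((t₀ - s) / k), ?_, fun t ht hle => ?_⟩
  · rcases le_total c₂.lo ((t₀ - s) / k) with h | h
    · rw [max_eq_right h, hd _ h, hkey]; exact ht₀
    · rw [max_eq_left h]; exact hs2
  · rw [he t ht]
    refine h₀ _ ((hd t ht.1).1 ht) ?_
    have := mul_le_mul_of_nonneg_left ((le_max_right _ _).trans hle) hk.le
    linarith

end Curve

/-! ### Envelopments, boundary sets and the abstract boundary -/

section Manifold

/-- An envelopment of an `n`-dimensional manifold `M`: a smooth open embedding into a smooth,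
Hausdorff, connected, paracompact manifold of the same dimension. -/
structure Envelopment (n : ℕ) (M : Type u) [TopologicalSpace M]
    [ChartedSpace (EuclideanSpace ℝ (Fin n)) M] where
  /-- the enveloping manifold -/
  Hat : Type u
  [top : TopologicalSpace Hat]
  [charted : ChartedSpace (EuclideanSpace ℝ (Fin n)) Hat]
  [manifold : IsManifold (𝓡 n) ∞ Hat]
  [t2 : T2Space Hat]
  [connected : ConnectedSpace Hat]
  [paracompact : ParacompactSpace Hat]
  /-- the embedding -/
  toFun : M → Hat
  isOpenEmbedding : IsOpenEmbedding toFun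
  isLocalDiffeomorph : IsLocalDiffeomorph (𝓡 n) (𝓡 n) ∞ toFun

attribute [instance] Envelopment.top Envelopment.charted Envelopment.manifold
  Envelopment.t2 Envelopment.connected Envelopment.paracompact

variable {n : ℕ} {M : Type u} [TopologicalSpace M] [ChartedSpace (EuclideanSpace ℝ (Fin n)) M]

/-- The topological boundary `∂_φ M` of `φ(M)` in the enveloping manifold. -/
def Envelopment.boundary (φ : Envelopment n M) : Set φ.Hat := frontier (range φ.toFun)

variable (n M) in
/-- A boundary set: a non-empty subset of the boundary of some envelopment. -/
structure BoundarySet where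
  /-- the envelopment -/
  env : Envelopment n M
  /-- the set of boundary points -/
  carrier : Set env.Hat
  nonempty : carrier.Nonempty
  subset : carrier ⊆ env.boundary

/-- `B` covers `B'`: for every open `U ⊇ B` there is an open `U' ⊇ B'` with
`φ ∘ φ'⁻¹ (U' ∩ φ'(M)) ⊆ U`. -/
def BoundarySet.Covers (B B' : BoundarySet n M) : Prop :=
  ∀ U : Set B.env.Hat, IsOpen U → B.carrier ⊆ U →
    ∃ U' : Set B'.env.Hat, IsOpen U' ∧ B'.carrier ⊆ U' ∧
      B.env.toFun '' (B'.env.toFun ⁻¹' U') ⊆ U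

theorem BoundarySet.Covers.refl (B : BoundarySet n M) : B.Covers B := fun U hU hB =>
  ⟨U, hU, hB, by rintro _ ⟨x, hx, rfl⟩; exact hx⟩

theorem BoundarySet.Covers.trans {B₁ B₂ B₃ : BoundarySet n M}
    (h₁ : B₁.Covers B₂) (h₂ : B₂.Covers B₃) : B₁.Covers B₃ := by
  intro U hU hB
  obtain ⟨V, hV, hBV, hVU⟩ := h₁ U hU hB
  obtain ⟨W, hW, hBW, hWV⟩ := h₂ V hV hBV
  exact ⟨W, hW, hBW, by rintro _ ⟨x, hx, rfl⟩; exact hVU ⟨x, hWV ⟨x, hx, rfl⟩, rfl⟩⟩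

variable (n M) in
/-- Equivalence of boundary sets: mutual covering. -/
def boundarySetoid : Setoid (BoundarySet n M) where
  r B B' := B.Covers B' ∧ B'.Covers B
  iseqv :=
    { refl := fun B => ⟨.refl B, .refl B⟩
      symm := fun h => ⟨h.2, h.1⟩
      trans := fun h h' => ⟨h.1.trans h'.1, h'.2.trans h.2⟩ }

/-- The singleton boundary set of a boundary point. -/
def Envelopment.single (φ : Envelopment n M) (p : φ.Hat) (hp : p ∈ φ.boundary) :
    BoundarySet n M where
  env := φ
  carrier := {p}
  nonempty := singleton_nonempty p
  subset := singleton_subset_iff.2 hp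

variable (n M) in
/-- The abstract boundary (`a` boundary) of `M`: the classes of boundary sets, over all
envelopments, that are represented by a single boundary point. -/
def AbstractBoundary : Type (u + 1) :=
  {A : Quotient (boundarySetoid n M) //
    ∃ (φ : Envelopment n M) (p : φ.Hat) (hp : p ∈ φ.boundary),
      A = Quotient.mk (boundarySetoid n M) (φ.single p hp)}

/-- The abstract boundary point `[p]` of a boundary point `p ∈ ∂_φ M`. -/
def Envelopment.abstractPoint (φ : Envelopment n M) (p : φ.Hat) (hp : p ∈ φ.boundary) :
    AbstractBoundary n M :=
  ⟨Quotient.mk (boundarySetoid n M) (φ.single p hp), φ, p, hp, rfl⟩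

/-- A boundary point `p` is attached to the open set `O ⊆ M` if every open neighbourhood of `p`
meets `φ(O)`. -/
def Envelopment.PointAttached (φ : Envelopment n M) (p : φ.Hat) (O : Set M) : Prop :=
  ∀ U : Set φ.Hat, IsOpen U → p ∈ U → (U ∩ φ.toFun '' O).Nonempty

/-- An abstract boundary point `[p]` is attached to `O` if the boundary point `p` is. -/
def AbstractBoundary.AttachedTo (A : AbstractBoundary n M) (O : Set M) : Prop :=
  ∃ (φ : Envelopment n M) (p : φ.Hat) (hp : p ∈ φ.boundary),
    A = φ.abstractPoint p hp ∧ φ.PointAttached p O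

variable (n M) in
/-- The attached point topology on the disjoint union of `M` and its abstract boundary.  It is
generated by the sets `O ∪ B ∪ C`, where `O` is open in `M`, `B` is the set of all abstract
boundary points attached to `O`, and `C` is any subset of the abstract boundary. -/
@[reducible] def attachedPointTopology : TopologicalSpace (M ⊕ AbstractBoundary n M) :=
  TopologicalSpace.generateFrom
    {W | ∃ (O : Set M) (C : Set (AbstractBoundary n M)), IsOpen O ∧
      W = Sum.inl '' O ∪ Sum.inr '' ({A | A.AttachedTo O} ∪ C)}

/-- The abstract boundary carries the topology induced by the attached point topology. -/
instance : TopologicalSpace (AbstractBoundary n M) :=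
  TopologicalSpace.induced Sum.inr (attachedPointTopology n M)

/-! ### Lorentz metrics and geodesics -/

variable (n M) in
/-- A smooth Lorentz metric, of signature `(-, +, …, +)`. -/
structure LorentzMetric [IsManifold (𝓡 n) ∞ M] where
  /-- the bilinear form on each tangent space -/
  val (x : M) : TangentSpace (𝓡 n) x →L[ℝ] TangentSpace (𝓡 n) x →L[ℝ] ℝ
  symm (x : M) (v w : TangentSpace (𝓡 n) x) : val x v w = val x w v
  signature (x : M) : ∃ v : TangentSpace (𝓡 n) x, val x v v < 0 ∧
    ∀ w : TangentSpace (𝓡 n) x, val x v w = 0 → w ≠ 0 → 0 < val x w w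
  contMDiff : ContMDiff (𝓡 n)
    ((𝓡 n).prod 𝓘(ℝ, EuclideanSpace ℝ (Fin n) →L[ℝ] EuclideanSpace ℝ (Fin n) →L[ℝ] ℝ)) ∞
    (fun x => Bundle.TotalSpace.mk'
      (EuclideanSpace ℝ (Fin n) →L[ℝ] EuclideanSpace ℝ (Fin n) →L[ℝ] ℝ)
      (E := fun x : M => TangentSpace (𝓡 n) x →L[ℝ] TangentSpace (𝓡 n) x →L[ℝ] ℝ) x (val x))

variable [IsManifold (𝓡 n) ∞ M]

/-- Time orientability: there is a continuous timelike vector field. -/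
def LorentzMetric.TimeOrientable (g : LorentzMetric n M) : Prop :=
  ∃ X : ∀ x : M, TangentSpace (𝓡 n) x,
    Continuous (fun x => (⟨x, X x⟩ : TangentBundle (𝓡 n) M)) ∧ ∀ x, g.val x (X x) (X x) < 0

/-- The components of the metric in the chart around `x₀`: the value of the pulled back metric, at
the coordinates `y`, on the coordinate vectors `v` and `w`. -/
def LorentzMetric.inChart (g : LorentzMetric n M) (x₀ : M)
    (y v w : EuclideanSpace ℝ (Fin n)) : ℝ :=
  g.val ((extChartAt (𝓡 n) x₀).symm y)
    (mfderiv 𝓘(ℝ, EuclideanSpace ℝ (Fin n)) (𝓡 n) (extChartAt (𝓡 n) x₀).symm y v)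
    (mfderiv 𝓘(ℝ, EuclideanSpace ℝ (Fin n)) (𝓡 n) (extChartAt (𝓡 n) x₀).symm y w)

/-- The velocity vector of a curve, as a point of the tangent bundle. -/
def Curve.velocity (n : ℕ) {M : Type u} [TopologicalSpace M]
    [ChartedSpace (EuclideanSpace ℝ (Fin n)) M] (γ : Curve M) (t : ℝ) :
    TangentBundle (𝓡 n) M :=
  ⟨γ.toFun t, mfderivWithin 𝓘(ℝ, ℝ) (𝓡 n) γ.toFun γ.domain t (1 : ℝ)⟩

/-- `γ` is an affinely parametrized geodesic of the Levi-Civita connection of `g`: it is `C²`, and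
its expression `c` in any chart satisfies `∑ⱼ gₖⱼ c̈ʲ + ∑ᵢⱼ (∂ᵢ gₖⱼ - ½ ∂ₖ gᵢⱼ) ċⁱ ċʲ = 0` for
all `k`, that is, `c̈ᵏ + ∑ᵢⱼ Γᵏᵢⱼ ċⁱ ċʲ = 0` with the lower index `k`.  The equation is written
after contraction with an arbitrary coordinate vector `w`. -/
def LorentzMetric.IsGeodesic (g : LorentzMetric n M) (γ : Curve M) : Prop :=
  ContMDiffOn 𝓘(ℝ, ℝ) (𝓡 n) 2 γ.toFun γ.domain ∧
  ∀ x₀ : M, ∀ t ∈ γ.domain, γ.toFun t ∈ (chartAt (EuclideanSpace ℝ (Fin n)) x₀).source →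
    ∀ w : EuclideanSpace ℝ (Fin n),
      let c : ℝ → EuclideanSpace ℝ (Fin n) := fun s => extChartAt (𝓡 n) x₀ (γ.toFun s)
      let c' := derivWithin c γ.domain
      let c'' := derivWithin c' γ.domain
      g.inChart x₀ (c t) (c'' t) w
        + fderiv ℝ (fun y => g.inChart x₀ y (c' t) w) (c t) (c' t)
        - (1 / 2) * fderiv ℝ (fun y => g.inChart x₀ y (c' t) (c' t)) (c t) w = 0

variable (n M) in
/-- The reduced tangent bundle `G`: the non-zero tangent vectors `(p, ξ)`. -/
structure ReducedTangentBundle where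
  /-- the base point `p` -/
  pt : M
  /-- the tangent vector `ξ` -/
  vec : TangentSpace (𝓡 n) pt
  vec_ne_zero : vec ≠ 0

/-- `γ` is a geodesic `[0, b) → M` with `γ(0) = p` and `γ'(0) = ξ`. -/
def LorentzMetric.IsGeodesicFrom (g : LorentzMetric n M) (v : ReducedTangentBundle n M)
    (γ : Curve M) : Prop :=
  g.IsGeodesic γ ∧ γ.lo = 0 ∧ γ.velocity n 0 = (⟨v.pt, v.vec⟩ : TangentBundle (𝓡 n) M)

/-- The geodesic `γ : [0, b) → M` with `γ(0) = p` and `γ'(0) = ξ` has been extended as far as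
possible. -/
def LorentzMetric.IsMaximalGeodesicFrom (g : LorentzMetric n M)
    (v : ReducedTangentBundle n M) (γ : Curve M) : Prop :=
  g.IsGeodesicFrom v γ ∧ ∀ δ : Curve M, g.IsGeodesicFrom v δ → γ.IsSubcurve δ → δ.hi = γ.hi

open Classical in
/-- The geodesic `γ_p : [0, b) → M` associated with `(p, ξ)`: the maximal geodesic with
`γ(0) = p` and `γ'(0) = ξ`.  By the theory of ordinary differential equations exactly one exists
(up to its irrelevant values off `[0, b)`), so that the second case never occurs. -/
def LorentzMetric.geodesic (g : LorentzMetric n M) (v : ReducedTangentBundle n M) : Curve M :=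
  if h : ∃ γ, g.IsMaximalGeodesicFrom v γ then h.choose else ⟨0, 1, by simp, fun _ => v.pt⟩

/-! ### The modified `g` boundary -/

variable (g : LorentzMetric n M) (φ : Envelopment n M)

/-- The set `S(O)` of those `(p, ξ) ∈ G` whose geodesic `γ_p` lies in `O` and for which there is an
abstract boundary point `[p̂]`, `p̂ ∈ ∂_φ M`, attached to `O`, such that for every open
neighbourhood `N` of `p̂` some subcurve of `φ(γ_p)` lies in `φ(O) ∩ N`. -/
def basicOpen (O : Set M) : Set (ReducedTangentBundle n M) :=
  {v | ((g.geodesic v).map φ.toFun).trace ⊆ φ.toFun '' O ∧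
    ∃ (p : φ.Hat) (hp : p ∈ φ.boundary), (φ.abstractPoint p hp).AttachedTo O ∧
      ∀ N : Set φ.Hat, IsOpen N → p ∈ N →
        ∃ γ' : Curve φ.Hat, γ'.IsSubcurve ((g.geodesic v).map φ.toFun) ∧
          γ'.trace ⊆ φ.toFun '' O ∩ N}

/-- The topology on `G` generated by the sets `S(O)`, for `O` open in `M`. -/
@[reducible] def reducedTopology : TopologicalSpace (ReducedTangentBundle n M) :=
  TopologicalSpace.generateFrom {W | ∃ O : Set M, IsOpen O ∧ W = basicOpen g φ O}

/-- The elements of `G` whose geodesic approaches a boundary point in `∂_φ M`. -/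
def ApproachingVector : Type u :=
  {v : ReducedTangentBundle n M //
    ∃ p ∈ φ.boundary, ((g.geodesic v).map φ.toFun).Approaches p}

/-- The topology induced from `G`. -/
instance : TopologicalSpace (ApproachingVector g φ) :=
  TopologicalSpace.induced Subtype.val (reducedTopology g φ)

/-- A curve in the enveloping manifold approaches the abstract boundary point `A`, represented by
a boundary point of `φ`. -/
def Envelopment.ApproachesAbstract (φ : Envelopment n M) (c : Curve φ.Hat)
    (A : AbstractBoundary n M) : Prop :=
  ∃ (p : φ.Hat) (hp : p ∈ φ.boundary), A = φ.abstractPoint p hp ∧ c.Approaches p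

theorem Envelopment.ApproachesAbstract.unique {φ : Envelopment n M} {c : Curve φ.Hat}
    {A A' : AbstractBoundary n M}
    (h : φ.ApproachesAbstract c A) (h' : φ.ApproachesAbstract c A') : A = A' := by
  obtain ⟨p, hp, rfl, hc⟩ := h
  obtain ⟨q, hq, rfl, hc'⟩ := h'
  obtain rfl := hc.unique hc'
  rfl

/-- The equivalence relation `E₁`: the geodesics of the two vectors approach the same abstract
boundary point. -/
def relE₁ : Setoid (ApproachingVector g φ) where
  r v w := ∃ A : AbstractBoundary n M,
    φ.ApproachesAbstract ((g.geodesic v.1).map φ.toFun) A ∧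
      φ.ApproachesAbstract ((g.geodesic w.1).map φ.toFun) A
  iseqv :=
    { refl := fun v => by
        obtain ⟨p, hp, h⟩ := v.2
        exact ⟨φ.abstractPoint p hp, ⟨p, hp, rfl, h⟩, ⟨p, hp, rfl, h⟩⟩
      symm := fun ⟨A, h, h'⟩ => ⟨A, h', h⟩
      trans := fun ⟨A, h, h'⟩ ⟨A', k, k'⟩ => ⟨A, h, by rwa [h'.unique k]⟩ }

/-- The modified `g` boundary `g̃`, with the quotient topology. -/
def GTilde : Type u := Quotient (relE₁ g φ)

instance : TopologicalSpace (GTilde g φ) :=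
  inferInstanceAs (TopologicalSpace (Quotient (relE₁ g φ)))

/-- The canonical quotient map `q`. -/
def q (v : ApproachingVector g φ) : GTilde g φ := Quotient.mk (relE₁ g φ) v

/-! ### The maps `κ`, `r` and `L` -/

/-- The geodesics of `φ(M)`: the images under `φ` of the geodesics of the vectors in `G` that
approach a point of `∂_φ M`. -/
def GeodesicImage : Type u :=
  {c : Curve φ.Hat // ∃ v : ApproachingVector g φ, c = (g.geodesic v.1).map φ.toFun}

theorem GeodesicImage.exists_approaches {g : LorentzMetric n M} {φ : Envelopment n M}
    (c : GeodesicImage g φ) :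
    ∃ A : AbstractBoundary n M, φ.ApproachesAbstract c.1 A := by
  obtain ⟨_, v, rfl⟩ := c
  obtain ⟨p, hp, h⟩ := v.2
  exact ⟨φ.abstractPoint p hp, p, hp, rfl, h⟩

theorem Envelopment.ApproachesAbstract.of_same {φ : Envelopment n M} {c₁ c₂ : Curve φ.Hat}
    {A₁ A₂ : AbstractBoundary n M} (h : c₁.SameGeodesic c₂)
    (h₁ : φ.ApproachesAbstract c₁ A₁) (h₂ : φ.ApproachesAbstract c₂ A₂) :
    φ.ApproachesAbstract c₁ A₂ := by
  obtain ⟨p, hp, rfl, hc⟩ := h₁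
  obtain ⟨q, hq, rfl, hc'⟩ := h₂
  refine ⟨q, hq, rfl, ?_⟩
  rcases h with h | h
  · rw [← (h.approaches hc).unique hc']; exact hc
  · exact h.approaches hc'

/-- The relation underlying `E₂`: the two curves belong to the same geodesic, or they approach the
same abstract boundary point. -/
def RelE₂ (c₁ c₂ : GeodesicImage g φ) : Prop :=
  c₁.1.SameGeodesic c₂.1 ∨
    ∃ A : AbstractBoundary n M, φ.ApproachesAbstract c₁.1 A ∧ φ.ApproachesAbstract c₂.1 A

theorem RelE₂.approaches {g : LorentzMetric n M} {φ : Envelopment n M}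
    {c₁ c₂ : GeodesicImage g φ} (h : RelE₂ g φ c₁ c₂) :
    ∃ A : AbstractBoundary n M, φ.ApproachesAbstract c₁.1 A ∧ φ.ApproachesAbstract c₂.1 A := by
  rcases h with h | h
  · obtain ⟨A₁, h₁⟩ := c₁.exists_approaches
    obtain ⟨A₂, h₂⟩ := c₂.exists_approaches
    exact ⟨A₂, .of_same h h₁ h₂, h₂⟩
  · exact h

/-- The equivalence relation `E₂`. -/
def relE₂ : Setoid (GeodesicImage g φ) where
  r := RelE₂ g φ
  iseqv :=
    { refl := fun c => Or.inr (by
        obtain ⟨A, h⟩ := c.exists_approaches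
        exact ⟨A, h, h⟩)
      symm := fun h => by
        obtain ⟨A, h₁, h₂⟩ := h.approaches
        exact Or.inr ⟨A, h₂, h₁⟩
      trans := fun h k => by
        obtain ⟨A, h₁, h₂⟩ := h.approaches
        obtain ⟨A', k₁, k₂⟩ := k.approaches
        exact Or.inr ⟨A, h₁, by rwa [h₂.unique k₁]⟩ }

/-- The space `φ(M)_geo` of classes of geodesics in `φ(M)` under `E₂`. -/
def GeodesicClass : Type u := Quotient (relE₂ g φ)

/-- The map `κ : (p, ξ) ↦ [φ(γ_p)]`. -/
def kappa (v : ApproachingVector g φ) : GeodesicClass g φ :=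
  Quotient.mk (relE₂ g φ) ⟨(g.geodesic v.1).map φ.toFun, v, rfl⟩

/-- The map `r : g̃ → φ(M)_geo` induced by `κ`, so that `r ∘ q = κ`. -/
def r : GTilde g φ → GeodesicClass g φ :=
  Quotient.lift (kappa g φ) fun _ _ h => Quotient.sound (s := relE₂ g φ) (Or.inr h)

/-- The limit operator `L`, which sends a class of geodesics of `φ(M)` to the abstract boundary
point that they approach. -/
def L : GeodesicClass g φ → AbstractBoundary n M :=
  Quotient.lift (fun c : GeodesicImage g φ => c.exists_approaches.choose) fun c₁ c₂ h => by
    obtain ⟨A, h₁, h₂⟩ := RelE₂.approaches h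
    exact (c₁.exists_approaches.choose_spec.unique h₁).trans
      (h₂.unique c₂.exists_approaches.choose_spec)

end Manifold

end SpacetimeBoundary

end

namespace SpacetimeBoundary

/-! ### Separating a convergent set from a closed set -/

section Topology

/-! Both spaces are discrete, so the theorem reduces to well-definedness and injectivity of `L ∘ r`,
which are built into the equivalence relations and the uniqueness of limits.

The abstract boundary is discrete because no point is attached to the empty set: the basic set with
`O = ∅` and `C = {A}` traces out exactly `{A}`.

The discreteness of `GTilde` is the substantial part. Let the geodesic of `v` approach `p ∈ ∂_φ M`,
and let `K` be the trace of its image in the enveloping manifold. It suffices to find an open `U ⊇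
K` whose closure meets `∂_φ M` in at most `p`. With `O = φ⁻¹(U)`, any geodesic lying in `O` has its
limit in the closure of `U`, so a limit in `∂_φ M` must be `p`; hence `S(O)` cuts out an open
neighbourhood of `v` inside its class. Every class is therefore open in `G_φ`.

The set `U` comes from `exists_isOpen_closure_inter_subset_singleton`. Outside a neighbourhood of
`p`, `K` is compact and can be fattened away from the closed set `∂_φ M`. Near `p`, the sets `K` and
`∂_φ M \ {p}` need not have disjoint closures, but neither meets the closure of the other, so
complete normality of a chart domain separates them. -/

/-- In a Hausdorff space, a set that becomes compact after removing any neighbourhood of `p` is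
closed up to the point `p`. -/
theorem closure_subset_insert_of_isCompact_diff {X : Type*} [TopologicalSpace X] [T2Space X]
    {K : Set X} {p : X} (hK : ∀ N, IsOpen N → p ∈ N → IsCompact (K \ N)) :
    closure K ⊆ insert p K := by
  intro x hx
  by_contra hne
  obtain ⟨hxp, hxK⟩ := not_or.1 hne
  obtain ⟨V, N, hV, hN, hxV, hpN, hd⟩ := t2_separation hxp
  -- Inside `V`, which misses a neighbourhood of `p`, the set `K` agrees with part of a compact,
  -- hence closed, set.
  have hsub : V ∩ K ⊆ K \ N := fun y hy => ⟨hy.2, fun h => disjoint_left.1 hd hy.1 h⟩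
  exact hxK (closure_minimal hsub (hK N hN hpN).isClosed
    (hV.inter_closure ⟨hxV, hx⟩)).1

/-- A set converging to a point `p` and disjoint from a closed set `D` has an open neighbourhood
whose closure meets `D` at most in `p`. -/
theorem exists_isOpen_closure_inter_subset_singleton {X : Type*} [TopologicalSpace X] [T2Space X]
    [LocallyCompactSpace X] {K D W : Set X} {p : X}
    (hK : ∀ N, IsOpen N → p ∈ N → IsCompact (K \ N)) (hD : IsClosed D) (hKD : Disjoint K D)
    (hW : IsOpen W) (hpW : p ∈ W) [SecondCountableTopology W] :
    ∃ U, IsOpen U ∧ K ⊆ U ∧ closure U ∩ D ⊆ {p} := by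
  -- `F` is taken closed so that limits of points of `F` stay in `W`, where the separation below
  -- applies.
  obtain ⟨F, hFp, hFc, hFW⟩ := exists_mem_nhds_isClosed_subset (hW.mem_nhds hpW)
  obtain ⟨T, hT, hKT, hTD⟩ := exists_compact_between
    (hK _ isOpen_interior (mem_interior_iff_mem_nhds.2 hFp)) hD.isOpen_compl
    (sdiff_subset.trans hKD.subset_compl_right)
  -- `W` is regular and second countable, hence completely normal. Within it, `K` can accumulate
  -- outside itself only at `p`, which has been removed from `D`, while limits of `D \ {p}` lie in
  -- `D`, which misses `K`.
  obtain ⟨A, B, hA, hB, hKA, hDB, hAB⟩ : SeparatedNhds ((↑) ⁻¹' K : Set W)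
      ((↑) ⁻¹' (D \ {p})) := by
    refine separatedNhds_iff_disjoint.2 (CompletelyNormalSpace.completely_normal ?_ ?_)
    · refine disjoint_left.2 fun x hx hxD => ?_
      have := closure_subset_insert_of_isCompact_diff hK
        (continuous_subtype_val.closure_preimage_subset K hx)
      exact this.elim hxD.2 fun h => disjoint_left.1 hKD h hxD.1
    · refine disjoint_left.2 fun x hx hxD => ?_
      have := closure_mono sdiff_subset
        (continuous_subtype_val.closure_preimage_subset (D \ {p}) hxD)
      rw [hD.closure_eq] at this
      exact disjoint_left.1 hKD hx this
  have hA' := hW.isOpenMap_subtype_val A hA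
  have hB' := hW.isOpenMap_subtype_val B hB
  -- The compact fattening `T` handles the part of `K` away from `p`; `A`, cut down to `F`, handles
  -- the part near `p`.
  refine ⟨interior T ∪ ((↑) '' A ∩ interior F), isOpen_interior.union (hA'.inter isOpen_interior),
    fun x hx => ?_, ?_⟩
  · by_cases hxF : x ∈ interior F
    · exact Or.inr ⟨⟨⟨x, hFW (interior_subset hxF)⟩, hKA hx, rfl⟩, hxF⟩
    · exact Or.inl (hKT ⟨hx, hxF⟩)
  · rintro x ⟨hx, hxD⟩
    rw [closure_union] at hx
    rcases hx with hx | hx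
    · exact absurd hxD (hTD (closure_minimal interior_subset hT.isClosed hx))
    · by_contra hxp
      have hxF : x ∈ F := closure_minimal (inter_subset_right.trans interior_subset) hFc hx
      -- A point of `D` other than `p` would lie in the open image of `B`, which would then have to
      -- meet `A`.
      obtain ⟨_, ⟨b, hb, rfl⟩, ⟨a, ha, hab⟩, -⟩ := mem_closure_iff.1 hx _ hB'
        ⟨⟨x, hFW hxF⟩, hDB ⟨hxD, hxp⟩, rfl⟩
      rw [Subtype.ext hab] at ha
      exact disjoint_left.1 hAB ha hb

end Topology

/-! ### Traces of convergent curves -/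

namespace Curve

variable {X : Type*} [TopologicalSpace X] {γ : Curve X} {x : X}

/-- The curve eventually stays in `N`, so only a compact initial parameter interval contributes.
This supplies the compactness hypothesis of the separation lemma. -/
theorem Approaches.isCompact_trace_diff (h : γ.Approaches x) (hγ : ContinuousOn γ.toFun γ.domain)
    {N : Set X} (hN : IsOpen N) (hx : x ∈ N) : IsCompact (γ.trace \ N) := by
  obtain ⟨t₀, ht₀, h₀⟩ := h N (hN.mem_nhds hx)
  have hI : Icc γ.lo t₀ ⊆ γ.domain := fun t ht =>
    ⟨ht.1, lt_of_le_of_lt (EReal.coe_le_coe_iff.2 ht.2) ht₀.2⟩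
  have heq : γ.trace \ N = γ.toFun '' Icc γ.lo t₀ \ N := by
    ext y
    constructor
    · rintro ⟨⟨t, ht, rfl⟩, hy⟩
      exact ⟨⟨t, ⟨ht.1, le_of_not_ge fun hle => hy (h₀ t ht hle)⟩, rfl⟩, hy⟩
    · rintro ⟨⟨t, ht, rfl⟩, hy⟩
      exact ⟨⟨t, hI ht, rfl⟩, hy⟩
  rw [heq]
  exact (isCompact_Icc.image_of_continuousOn (hγ.mono hI)).diff hN

theorem Approaches.mem_closure_trace (h : γ.Approaches x) : x ∈ closure γ.trace := by
  refine mem_closure_iff_nhds.2 fun N hN => ?_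
  obtain ⟨t₀, ht₀, h₀⟩ := h N hN
  exact ⟨γ.toFun t₀, h₀ t₀ ht₀ le_rfl, t₀, ht₀, rfl⟩

/-- A final portion of the curve serves; this is the subcurve condition in the definition of `S(O)`.
-/
theorem Approaches.exists_subcurve (h : γ.Approaches x) {N : Set X} (hN : N ∈ 𝓝 x) :
    ∃ γ' : Curve X, γ'.IsSubcurve γ ∧ γ'.trace ⊆ γ.trace ∩ N := by
  obtain ⟨t₀, ht₀, h₀⟩ := h N hN
  refine ⟨⟨t₀, γ.hi, ht₀.2, γ.toFun⟩, ⟨ht₀.1, le_rfl, fun _ _ => rfl⟩, ?_⟩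
  rintro _ ⟨t, ht, rfl⟩
  have htd : t ∈ γ.domain := ⟨ht₀.1.trans ht.1, ht.2⟩
  exact ⟨⟨t, htd, rfl⟩, h₀ t htd ht.1⟩

end Curve

/-! ### Discreteness of the two boundaries, and injectivity -/

section Manifold

variable {n : ℕ} {M : Type*} [TopologicalSpace M] [ChartedSpace (EuclideanSpace ℝ (Fin n)) M]

theorem Envelopment.isClosed_boundary (φ : Envelopment n M) : IsClosed φ.boundary :=
  isClosed_frontier

theorem Envelopment.notMem_boundary (φ : Envelopment n M) (x : M) : φ.toFun x ∉ φ.boundary :=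
  fun h => disjoint_left.1
    (disjoint_frontier_iff_isOpen.2 φ.isOpenEmbedding.isOpen_range) h ⟨x, rfl⟩

theorem AbstractBoundary.not_attachedTo_empty (A : AbstractBoundary n M) : ¬ A.AttachedTo ∅ := by
  rintro ⟨φ, p, hp, -, h⟩
  simpa using h univ isOpen_univ (mem_univ p)

/-- The attached point topology induces the discrete topology on the abstract boundary. -/
instance AbstractBoundary.discreteTopology : DiscreteTopology (AbstractBoundary n M) := by
  refine discreteTopology_iff_isOpen_singleton.2 fun A =>
    (@isOpen_induced_iff _ _ (attachedPointTopology n M) _ _).2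
      ⟨_, TopologicalSpace.isOpen_generateFrom_of_mem ⟨∅, {A}, isOpen_empty, rfl⟩, ?_⟩
  ext B
  simp [B.not_attachedTo_empty]

variable [IsManifold (𝓡 n) ∞ M] (g : LorentzMetric n M) (φ : Envelopment n M)

theorem LorentzMetric.continuousOn_geodesic (v : ReducedTangentBundle n M) :
    ContinuousOn (g.geodesic v).toFun (g.geodesic v).domain := by
  unfold LorentzMetric.geodesic
  split_ifs with h
  · exact h.choose_spec.1.1.1.continuousOn
  -- The default curve in the definition of `geodesic` is constant, so existence of maximal
  -- geodesics is not needed here.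
  · exact continuousOn_const

variable {g φ}

/-- A geodesic that approaches `p ∈ ∂_φ M` lies in an open set `O` such that all geodesics that
lie in `O` and approach a point of `∂_φ M` approach `p`. -/
theorem exists_basicOpen_approaches {v : ReducedTangentBundle n M} {p : φ.Hat}
    (hp : p ∈ φ.boundary) (hv : ((g.geodesic v).map φ.toFun).Approaches p) :
    ∃ O : Set M, IsOpen O ∧ v ∈ basicOpen g φ O ∧ ∀ w ∈ basicOpen g φ O, ∀ x ∈ φ.boundary,
      ((g.geodesic w).map φ.toFun).Approaches x → x = p := by
  have hcont : ContinuousOn ((g.geodesic v).map φ.toFun).toFun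
      ((g.geodesic v).map φ.toFun).domain :=
    -- The remaining requirements of the separation lemma are local: a chart domain around `p`
    -- serves as the second countable `W`.
    φ.isOpenEmbedding.continuous.comp_continuousOn (g.continuousOn_geodesic v)
  have : LocallyCompactSpace φ.Hat := Manifold.locallyCompact_of_finiteDimensional (𝓡 n)
  have : SecondCountableTopology (chartAt (EuclideanSpace ℝ (Fin n)) p).source :=
    (chartAt (EuclideanSpace ℝ (Fin n)) p).secondCountableTopology_source
  obtain ⟨U, hU, hKU, hUp⟩ := exists_isOpen_closure_inter_subset_singleton
    (fun N hN hpN => hv.isCompact_trace_diff hcont hN hpN) φ.isClosed_boundary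
    (disjoint_left.2 (by rintro _ ⟨t, -, rfl⟩; exact φ.notMem_boundary _))
    (chartAt (EuclideanSpace ℝ (Fin n)) p).open_source (mem_chart_source _ p)
  have htr : ((g.geodesic v).map φ.toFun).trace ⊆ φ.toFun '' (φ.toFun ⁻¹' U) := by
    rintro _ ⟨t, ht, rfl⟩
    exact ⟨_, hKU ⟨t, ht, rfl⟩, rfl⟩
  -- The boundary point witnessing `v ∈ S(O)` is `p` itself, attached to `O` because it is a limit
  -- of the trace.
  refine ⟨φ.toFun ⁻¹' U, hU.preimage φ.isOpenEmbedding.continuous,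
    ⟨htr, p, hp, ⟨φ, p, hp, rfl, fun N hN hpN => ?_⟩, fun N hN hpN => ?_⟩,
    fun w hw x hx hwx => ?_⟩
  · exact (mem_closure_iff.1 hv.mem_closure_trace N hN hpN).mono (inter_subset_inter_right N htr)
  · obtain ⟨γ', hγ', h⟩ := hv.exists_subcurve (hN.mem_nhds hpN)
    exact ⟨γ', hγ', h.trans (inter_subset_inter_left N htr)⟩
  -- Only the containment of the geodesic of `w` in `O` matters: it puts the limit `x` in the
  -- closure of `U`.
  · exact hUp ⟨closure_mono (hw.1.trans (image_preimage_subset _ _)) hwx.mem_closure_trace, hx⟩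

/-- The modified `g` boundary is discrete. -/
instance GTilde.discreteTopology : DiscreteTopology (GTilde g φ) := by
  refine discreteTopology_iff_forall_isOpen.2 fun s => ?_
  -- The preimage of `s` is a union of classes, so it is enough that `S(O)`, restricted to
  -- approaching vectors, stays within the class of `v`.
  refine isOpen_coinduced.2 (isOpen_iff_forall_mem_open.2 fun v hv => ?_)
  obtain ⟨p, hp, hvp⟩ := v.2
  obtain ⟨O, hO, hvO, h⟩ := exists_basicOpen_approaches hp hvp
  refine ⟨Subtype.val ⁻¹' basicOpen g φ O, fun w hw => ?_,
    @isOpen_induced _ _ (reducedTopology g φ) _ _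
      (TopologicalSpace.isOpen_generateFrom_of_mem ⟨O, hO, rfl⟩), hvO⟩
  obtain ⟨x, hx, hwx⟩ := w.2
  obtain rfl := h w.1 hw x hx hwx
  have hvw : q g φ v = q g φ w :=
    Quotient.sound (s := relE₁ g φ)
      ⟨φ.abstractPoint x hx, ⟨x, hx, rfl, hvp⟩, ⟨x, hx, rfl, hwx⟩⟩
  change q g φ w ∈ s
  rw [← hvw]
  exact hv

/-- The value of `L` is a chosen limit of the representing curve, so the property comes with the
choice. Uniqueness of limits then turns it into the explicit formula for `L ∘ r`. -/
theorem approachesAbstract_L_r_q (v : ApproachingVector g φ) :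
    φ.ApproachesAbstract ((g.geodesic v.1).map φ.toFun) ((L g φ ∘ r g φ) (q g φ v)) :=
  (GeodesicImage.exists_approaches
    (⟨(g.geodesic v.1).map φ.toFun, v, rfl⟩ : GeodesicImage g φ)).choose_spec

/-- The common value of `L ∘ r` is an abstract boundary point approached by both geodesics, which is
exactly the relation `relE₁`. -/
theorem injective_L_comp_r : Function.Injective (L g φ ∘ r g φ) := by
  rintro ⟨v⟩ ⟨w⟩ h
  refine Quotient.sound (s := relE₁ g φ) ⟨_, approachesAbstract_L_r_q v, ?_⟩
  have hw := approachesAbstract_L_r_q w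
  exact (show (L g φ ∘ r g φ) (q g φ v) = (L g φ ∘ r g φ) (q g φ w) from h) ▸ hw

end Manifold

end SpacetimeBoundary

theorem theorem8 {n : ℕ} {M : Type*} [TopologicalSpace M]
    [ChartedSpace (EuclideanSpace ℝ (Fin n)) M] [IsManifold (𝓡 n) ∞ M]
    [T2Space M] [ConnectedSpace M] [ParacompactSpace M]
    (g : SpacetimeBoundary.LorentzMetric n M) (_hg : g.TimeOrientable)
    (φ : SpacetimeBoundary.Envelopment n M) :
    (∀ (v : SpacetimeBoundary.ApproachingVector g φ) (p : φ.Hat) (hp : p ∈ φ.boundary),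
      ((g.geodesic v.1).map φ.toFun).Approaches p →
        (SpacetimeBoundary.L g φ ∘ SpacetimeBoundary.r g φ) (SpacetimeBoundary.q g φ v)
          = φ.abstractPoint p hp) ∧
    Topology.IsEmbedding (SpacetimeBoundary.L g φ ∘ SpacetimeBoundary.r g φ) := by
  exact ⟨fun v p hp h =>
      (SpacetimeBoundary.approachesAbstract_L_r_q v).unique ⟨p, hp, rfl, h⟩,
    -- Discreteness of the source gives continuity and discreteness of the target gives openness.
    (Topology.IsOpenEmbedding.of_continuous_injective_isOpenMap continuous_of_discreteTopology
      SpacetimeBoundary.injective_L_comp_r fun _ _ => isOpen_discrete _).isEmbedding⟩
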